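/- Let $q\ge 3$ be an integer and let $\mathcal P=\{\nu\in\mathbb R^q:\nu_i\ge 0,\ \sum_{i=1}^q\nu_i=1\}$, $\rho=(\tfrac1q,\dots,\tfrac1q)$. For $\nu\in\mathcal P$ put $$R(\nu|\rho)=\sum_{i=1}^q\nu_i\log(q\nu_i)\quad(0\log 0=0),\qquad \tilde H(\nu)=-\tfrac12\langle\nu,\nu\rangle=-\tfrac12\sum_{i=1}^q\nu_i^2 .$$ For $\beta\in\mathbb R$ and $u\in\mathbb R$ define the sets of canonical and microcanonical equilibrium macrostates of the Curie--Weiss--Potts model $$\mathcal E_\beta=\Bigl\{\nu\in\mathcal P:\nu\text{ minimizes }R(\cdot|\rho)-\tfrac\beta2\langle\cdot,\cdot\rangle\text{ over }\mathcal P\Bigr\},$$ $$\mathcal E^u=\Bigl\{\nu\in\mathcal P:\nu\text{ minimizes }R(\cdot|\rho)\text{ over }\mathcal P\text{ subject to }\tilde H=u\Bigr\},$$ and the microcanonical entropy $s(u)=-\inf\{R(\nu|\rho):\nu\in\mathcal P,\ \tilde H(\nu)=u\}\in[-\infty,0]$. Let $$\beta_c=\frac{2(q-1)}{q-2}\log(q-1),\qquad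 u_0=\frac{-q^2+3q-3}{2q(q-1)} .$$ For $\beta>0$ let $w(\beta)$ be the largest real solution $w$ of $w=\dfrac{1-e^{-\beta w}}{1+(q-1)e^{-\beta w}}$, and let $$\nu^1(\beta)=\Bigl(\tfrac{1+(q-1)w(\beta)}q,\tfrac{1-w(\beta)}q,\dots,\tfrac{1-w(\beta)}q\Bigr).$$ Define the mean energy by $u(\beta)=\tilde H(\rho)=-\tfrac1{2q}$ for $\beta<\beta_c$ and $u(\beta)=\tilde H(\nu^1(\beta))$ for $\beta>\beta_c$. Let $F=(-\tfrac12,u_0)\cup\{-\tfrac1{2q}\}$. Then $\operatorname{int}F=(-\tfrac12,u_0)$ and the following hold. (a) (Full equivalence on $\operatorname{int}F$.) For every $u\in(-\tfrac12,u_0)$ there is a unique $\beta\in(\beta_c,\infty)$ such that $\mathcal E^u=\mathcal E_\beta$; this $\beta$ satisfies $u(\beta)=\tilde H(\nu^1(\beta))=u$. (b) For every $u\in(-\tfrac12,u_0)$ the function $s$ is finite in a neighbourhood of $u$ and differentiable at $u$, and the $\beta$ of part (a) satisfies $s'(u)=\beta$. (c) (Full equivalence at $-\tfrac1{2q}$.)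 $\mathcal E^{-1/(2q)}=\mathcal E_\beta$ for every $\beta<\beta_c$. (d) (Partial equivalence at $u_0$.) $\mathcal E^{u_0}$ is a proper subset of $\mathcal E_{\beta_c}$; in fact $\mathcal E_{\beta_c}=\mathcal E^{u_0}\cup\mathcal E^{-1/(2q)}$. (e) (Nonequivalence on $(u_0,-\tfrac1{2q})$.) For every $u\in(u_0,-\tfrac1{2q})$ and every $\beta\in\mathbb R$, $\mathcal E^u\cap\mathcal E_\beta=\emptyset$. -/

import Mathlib

namespace CurieWeissPotts

noncomputable section

/-- The set `𝒫` of probability vectors in `ℝ^q`. -/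
def probVec (q : ℕ) : Set (Fin q → ℝ) :=
  {ν | (∀ i, 0 ≤ ν i) ∧ ∑ i, ν i = 1}

/-- The uniform probability vector `ρ`. -/
def rho (q : ℕ) : Fin q → ℝ := fun _ => 1 / (q : ℝ)

/-- The relative entropy `R(ν|ρ) = ∑ ν_i log (q ν_i)`, where `0 log 0 = 0`. -/
def relEntropy {q : ℕ} (ν : Fin q → ℝ) : ℝ :=
  ∑ i, ν i * Real.log ((q : ℝ) * ν i)

/-- The energy representation function `H̃(ν) = -⟨ν, ν⟩ / 2`. -/
def energy {q : ℕ} (ν : Fin q → ℝ) : ℝ := -(1 / 2) * ∑ i, ν i * ν i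

/-- The set `ℰ_β` of canonical equilibrium macrostates: the minimizers over `𝒫` of
`R(ν|ρ) - (β/2) ⟨ν, ν⟩`. -/
def canonicalEq (q : ℕ) (β : ℝ) : Set (Fin q → ℝ) :=
  {ν | ν ∈ probVec q ∧ ∀ μ ∈ probVec q,
    relEntropy ν - β / 2 * ∑ i, ν i * ν i ≤ relEntropy μ - β / 2 * ∑ i, μ i * μ i}

/-- The set `ℰ^u` of microcanonical equilibrium macrostates: the minimizers over `𝒫` of
`R(ν|ρ)` subject to `H̃(ν) = u`. -/
def microEq (q : ℕ) (u : ℝ) : Set (Fin q → ℝ) :=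
  {ν | ν ∈ probVec q ∧ energy ν = u ∧ ∀ μ ∈ probVec q, energy μ = u →
    relEntropy ν ≤ relEntropy μ}

/-- The microcanonical entropy `s(u) = -inf {R(ν|ρ) : ν ∈ 𝒫, H̃(ν) = u} ∈ [-∞, 0]`
(the value is `-∞` when no `ν` satisfies the constraint). -/
def microEntropy (q : ℕ) (u : ℝ) : EReal :=
  -sInf {r : EReal | ∃ ν ∈ probVec q, energy ν = u ∧ r = (relEntropy ν : EReal)}

/-- The critical inverse temperature. -/
def betaC (q : ℕ) : ℝ := 2 * ((q : ℝ) - 1) / ((q : ℝ) - 2) * Real.log ((q : ℝ) - 1)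

/-- The mean-energy value `u_0`. -/
def uZero (q : ℕ) : ℝ := (-(q : ℝ) ^ 2 + 3 * q - 3) / (2 * q * ((q : ℝ) - 1))

/-- The mean-energy value `-1/(2q)`. -/
def uC (q : ℕ) : ℝ := -(1 / (2 * (q : ℝ)))

/-- The set of solutions `w` of the mean-field equation. -/
def wSolutions (q : ℕ) (β : ℝ) : Set ℝ :=
  {w | w = (1 - Real.exp (-β * w)) / (1 + ((q : ℝ) - 1) * Real.exp (-β * w))}

/-- The largest solution `w(β)` of the mean-field equation; see `isGreatest_wOf`. -/
def wOf (q : ℕ) (β : ℝ) : ℝ := sSup (wSolutions q β)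

/-- The largest solution exists. -/
theorem isGreatest_wOf {q : ℕ} (hq : 1 ≤ q) (β : ℝ) :
    IsGreatest (wSolutions q β) (wOf q β) := by
  have hq' : (0 : ℝ) ≤ (q : ℝ) - 1 := by
    have : (1 : ℝ) ≤ q := by exact_mod_cast hq
    linarith
  have hden : ∀ w : ℝ, 0 < 1 + ((q : ℝ) - 1) * Real.exp (-β * w) := fun w => by positivity
  have hne : (wSolutions q β).Nonempty := ⟨0, by simp [wSolutions]⟩
  have hbdd : BddAbove (wSolutions q β) := by
    refine ⟨1, fun w hw => ?_⟩
    rw [wSolutions, Set.mem_setOf_eq] at hw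
    rw [hw, div_le_one (hden w)]
    have h1 := Real.exp_pos (-β * w)
    have h2 := mul_nonneg hq' h1.le
    linarith
  have hcl : IsClosed (wSolutions q β) := by
    refine isClosed_eq continuous_id (Continuous.div ?_ ?_ fun w => (hden w).ne')
    · fun_prop
    · fun_prop
  exact ⟨hcl.csSup_mem hne hbdd, fun w hw => le_csSup hbdd hw⟩

/-- `ψ(w) = ((1 + (q-1) w)/q, (1-w)/q, …, (1-w)/q)`. -/
def psi (q : ℕ) (w : ℝ) : Fin q → ℝ :=
  fun i => if (i : ℕ) = 0 then (1 + ((q : ℝ) - 1) * w) / q else (1 - w) / q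

/-- The vector `ν¹(β) = ψ(w(β))`. -/
def nuOne (q : ℕ) (β : ℝ) : Fin q → ℝ := psi q (wOf q β)

/-- The mean energy `u(β)`, to be used for `β ≠ β_c` only:
`H̃(ρ)` for `β < β_c` and `H̃(ν¹(β))` for `β > β_c`. -/
def meanEnergy (q : ℕ) (β : ℝ) : ℝ :=
  if β < betaC q then energy (rho q) else energy (nuOne q β)

/-- The set `F` of full equivalence. -/
def setF (q : ℕ) : Set ℝ := Set.Ioo (-(1 / 2)) (uZero q) ∪ {uC q}

end

end CurieWeissPotts

/-! On a level set of `energy` the free energy and `relEntropy` differ by a constant. Hence if `ν`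
is canonical for `β`, the microcanonical set at `energy ν` is the part of `canonicalEq q β` on that
level (`microEq_eq_inter`). The constrained problem is never analysed directly: it is enough to know
which energies canonical minimizers take.

For `β > 0`, exchanging mass between two sites forces a minimizer to be a `spike`
(`canonicalEq_exists_spike`). What remains is `spikeFreeEnergy`, whose derivative is a positive
multiple of `meanField q w - β * w`. As `meanField` is concave, then convex, about `wCrit q / 2`,
and meets the line of slope `betaC q` at `0`, `wCrit q / 2` and `wCrit q`, the minimizers at `betaC
q` have `w = 0` or `w = wCrit q`.

Other `β` are compared with `betaC q`. Below it only energy `uC q` survives; above it `w` exceeds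
`wCrit q`, where `strictMonoOn_meanField_div` makes the stationary point unique. Inverting `β ↦ w ↦
u` gives (a), and differentiating the spike entropy along this curve gives (b). -/

namespace CurieWeissPotts

/-! ### The pairwise exchange argument -/

/-- The contribution of one coordinate to the canonical free energy. -/
noncomputable def siteEnergy (q : ℕ) (β x : ℝ) : ℝ := x * Real.log (q * x) - β / 2 * (x * x)

theorem hasDerivAt_siteEnergy {q : ℕ} (hq : 0 < q) (β : ℝ) {x : ℝ} (hx : 0 < x) :
    HasDerivAt (siteEnergy q β) (Real.log (q * x) + 1 - β * x) x := by
  have hq' : (0 : ℝ) < q := by exact_mod_cast hq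
  have h1 : HasDerivAt (fun y : ℝ => (q : ℝ) * y) (q : ℝ) x := by
    simpa using (hasDerivAt_id x).const_mul (q : ℝ)
  have h2 : HasDerivAt (siteEnergy q β) _ x :=
    ((hasDerivAt_id' x).mul (h1.log (by positivity))).sub
      (((hasDerivAt_id' x).mul (hasDerivAt_id' x)).const_mul (β / 2))
  refine h2.congr_deriv ?_
  field_simp
  ring

/-- The slope of `x log x` at `0` is `-∞`, so moving a little mass to an empty site pays off.
Minimizers therefore have no zero coordinate. -/
theorem siteEnergy_exchange_pos {q : ℕ} (hq : 0 < q) {β b : ℝ} (hβ : 0 < β) (hb : 0 < b) :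
    ∃ t ∈ Set.Icc 0 b, siteEnergy q β t + siteEnergy q β (b - t) < siteEnergy q β b := by
  have hq' : (0 : ℝ) < q := by exact_mod_cast hq
  have he : Real.exp (-(β * b) - 1) < 1 := by
    rw [Real.exp_lt_one_iff]
    have := mul_pos hβ hb
    linarith
  have hep := Real.exp_pos (-(β * b) - 1)
  -- The exponent cancels the quadratic cost `β * b * t`; the change is then at most `-t - β * t *
  -- t`.
  set t := b * Real.exp (-(β * b) - 1) with ht
  have ht0 : 0 < t := by positivity
  have htb : t < b := by
    rw [ht]; nlinarith
  refine ⟨t, ⟨ht0.le, htb.le⟩, ?_⟩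
  have hlt : Real.log (q * t) = Real.log (q * b) - β * b - 1 := by
    rw [ht, ← mul_assoc, Real.log_mul (by positivity) hep.ne', Real.log_exp]
    ring
  have hmono : Real.log (q * (b - t)) ≤ Real.log (q * b) := by
    apply Real.log_le_log
    · exact mul_pos hq' (by linarith)
    · apply mul_le_mul_of_nonneg_left _ hq'.le
      linarith
  have h3 := mul_le_mul_of_nonneg_left hmono (by linarith : (0 : ℝ) ≤ b - t)
  have h4 : 0 < β * t * t := by positivity
  unfold siteEnergy
  rw [hlt]
  nlinarith

theorem siteEnergy_deriv_eq {q : ℕ} (hq : 0 < q) {β a b : ℝ} (ha : 0 < a) (hb : 0 < b)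
    (h : ∀ t ∈ Set.Icc (-a) b,
      siteEnergy q β a + siteEnergy q β b ≤ siteEnergy q β (a + t) + siteEnergy q β (b - t)) :
    Real.log a - β * a = Real.log b - β * b := by
  have hq' : (0 : ℝ) < q := by exact_mod_cast hq
  have hmin : IsLocalMin (fun t => siteEnergy q β (a + t) + siteEnergy q β (b - t)) 0 := by
    filter_upwards [Icc_mem_nhds (by linarith : -a < 0) hb] with t ht
    simpa using h t ht
  have d1 : HasDerivAt (fun t => siteEnergy q β (a + t)) (Real.log (q * a) + 1 - β * a) 0 := by
    have := hasDerivAt_siteEnergy hq β (x := a + 0) (by simpa)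
    simpa using this.comp_const_add a 0
  have d2 : HasDerivAt (fun t => siteEnergy q β (b - t)) (-(Real.log (q * b) + 1 - β * b)) 0 := by
    have := hasDerivAt_siteEnergy hq β (x := b - 0) (by simpa)
    simpa using this.comp_const_sub b 0
  have := hmin.hasDerivAt_eq_zero (d1.add d2)
  rw [Real.log_mul hq'.ne' ha.ne', Real.log_mul hq'.ne' hb.ne'] at this
  linarith

/-- The derivative `1/x - β` changes sign at `1/β`. With the decreasing half below, a stationary
vector has at most two distinct entries, one on each side of `1/β`. -/
theorem strictMonoOn_log_sub_mul {β : ℝ} (hβ : 0 < β) :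
    StrictMonoOn (fun x => Real.log x - β * x) (Set.Ioc 0 (1 / β)) := by
  have hd : ∀ x : ℝ, 0 < x → HasDerivAt (fun x => Real.log x - β * x) (x⁻¹ - β) x := fun x hx =>
    ((Real.hasDerivAt_log hx.ne').sub ((hasDerivAt_id' x).const_mul β)).congr_deriv (by simp)
  refine strictMonoOn_of_deriv_pos (convex_Ioc _ _)
    (fun x hx => (hd x hx.1).continuousAt.continuousWithinAt) fun x hx => ?_
  rw [interior_Ioc] at hx
  rw [(hd x hx.1).deriv, sub_pos, lt_inv_comm₀ hβ hx.1]
  simpa using hx.2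

theorem strictAntiOn_log_sub_mul {β : ℝ} (hβ : 0 < β) :
    StrictAntiOn (fun x => Real.log x - β * x) (Set.Ici (1 / β)) := by
  have hd : ∀ x : ℝ, 0 < x → HasDerivAt (fun x => Real.log x - β * x) (x⁻¹ - β) x := fun x hx =>
    ((Real.hasDerivAt_log hx.ne').sub ((hasDerivAt_id' x).const_mul β)).congr_deriv (by simp)
  have hp : ∀ x, 1 / β ≤ x → 0 < x := fun x hx => lt_of_lt_of_le (by positivity) hx
  refine strictAntiOn_of_deriv_neg (convex_Ici _)
    (fun x hx => (hd x (hp x hx)).continuousAt.continuousWithinAt) fun x hx => ?_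
  rw [interior_Ici] at hx
  have hx0 := hp x (le_of_lt hx)
  rw [(hd x hx0).deriv, sub_neg, inv_lt_comm₀ hx0 hβ]
  simpa using hx

/-- Beyond `1/β` the site energy is strictly concave, so two equal entries there gain by spreading
apart. -/
theorem siteEnergy_exchange_large {q : ℕ} (hq : 0 < q) {β a : ℝ} (hβ : 0 < β) (ha : 1 / β < a) :
    ∃ t ∈ Set.Icc (-a) a,
      siteEnergy q β (a + t) + siteEnergy q β (a - t) < siteEnergy q β a + siteEnergy q β a := by
  have hq' : (0 : ℝ) < q := by exact_mod_cast hq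
  have hβ' : 0 < 1 / β := by positivity
  have hp : ∀ x, 1 / β ≤ x → 0 < x := fun x hx => lt_of_lt_of_le hβ' hx
  have hconc : StrictConcaveOn ℝ (Set.Ici (1 / β)) (siteEnergy q β) := by
    refine StrictAntiOn.strictConcaveOn_of_deriv (convex_Ici _)
      (fun x hx => (hasDerivAt_siteEnergy hq β (hp x hx)).continuousAt.continuousWithinAt) ?_
    rw [interior_Ici]
    intro x hx y hy hxy
    have hx' : 1 / β ≤ x := le_of_lt hx
    have hy' : 1 / β ≤ y := le_of_lt hy
    rw [(hasDerivAt_siteEnergy hq β (hp x hx')).deriv, (hasDerivAt_siteEnergy hq β (hp y hy')).deriv,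
      Real.log_mul hq'.ne' (hp x hx').ne', Real.log_mul hq'.ne' (hp y hy').ne']
    have := strictAntiOn_log_sub_mul hβ hx' hy' hxy
    simp only at this
    linarith
  -- The largest spread that keeps both entries in the concave region.
  refine ⟨a - 1 / β, ⟨by linarith, by linarith⟩, ?_⟩
  have hmid := hconc.2
  have := @hmid (a + (a - 1 / β)) (by simp only [Set.mem_Ici]; linarith)
    (a - (a - 1 / β)) (by simp only [Set.mem_Ici]; linarith)
    (by intro h; linarith) (1 / 2) (1 / 2) (by norm_num) (by norm_num) (by norm_num)
  simp only [smul_eq_mul] at this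
  rw [show 1 / 2 * (a + (a - 1 / β)) + 1 / 2 * (a - (a - 1 / β)) = a by ring] at this
  linarith

/-! ### Vectors with one distinguished coordinate -/

/-- The vector with entry `(1 + (q-1) w) / q` at `i` and `(1 - w) / q` elsewhere. -/
noncomputable def spike (q : ℕ) (i : Fin q) (w : ℝ) : Fin q → ℝ :=
  fun j => if j = i then (1 + ((q : ℝ) - 1) * w) / q else (1 - w) / q

theorem psi_eq_spike {q : ℕ} (hq : 0 < q) (w : ℝ) : psi q w = spike q ⟨0, hq⟩ w := by
  funext j
  simp [psi, spike, Fin.ext_iff]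

theorem rho_eq_spike {q : ℕ} (i : Fin q) : rho q = spike q i 0 := by
  funext j
  simp [rho, spike]

theorem sum_comp_ite {q : ℕ} (f : ℝ → ℝ) (i : Fin q) (a b : ℝ) :
    ∑ j, f (if j = i then a else b) = f a + ((q : ℝ) - 1) * f b := by
  have hq : 1 ≤ q := i.pos
  rw [← Finset.add_sum_erase _ _ (Finset.mem_univ i), Finset.sum_congr rfl
    (fun j hj => by rw [if_neg (Finset.ne_of_mem_erase hj)])]
  simp [Nat.cast_sub hq]

theorem sum_spike_mul_self {q : ℕ} (i : Fin q) (w : ℝ) :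
    ∑ j, spike q i w j * spike q i w j = (1 + ((q : ℝ) - 1) * w ^ 2) / q := by
  have hq : (0 : ℝ) < q := by exact_mod_cast i.pos
  rw [show ∑ j, spike q i w j * spike q i w j = _ from sum_comp_ite (fun x => x * x) i _ _]
  field_simp
  ring

theorem spike_mem_probVec {q : ℕ} (i : Fin q) {w : ℝ} (h0 : 0 ≤ w) (h1 : w ≤ 1) :
    spike q i w ∈ probVec q := by
  have hq : (1 : ℝ) ≤ q := by exact_mod_cast i.pos
  have hq0 : (0 : ℝ) < q := by linarith
  constructor
  · intro j
    unfold spike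
    split_ifs
    · have := mul_nonneg (sub_nonneg.2 hq) h0
      positivity
    · exact div_nonneg (by linarith) hq0.le
  · rw [show ∑ j, spike q i w j = _ from sum_comp_ite (fun x => x) i _ _]
    field_simp
    ring

/-- The relative entropy of `spike q i w`. -/
noncomputable def spikeEntropy (q : ℕ) (w : ℝ) : ℝ :=
  (1 + ((q : ℝ) - 1) * w) / q * Real.log (1 + ((q : ℝ) - 1) * w) +
    ((q : ℝ) - 1) * ((1 - w) / q * Real.log (1 - w))

theorem relEntropy_spike {q : ℕ} (i : Fin q) (w : ℝ) :
    relEntropy (spike q i w) = spikeEntropy q w := by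
  have hq : (q : ℝ) ≠ 0 := by exact_mod_cast i.pos.ne'
  unfold relEntropy
  rw [show ∑ j, spike q i w j * Real.log (q * spike q i w j) = _ from
    sum_comp_ite (fun x => x * Real.log (q * x)) i _ _]
  simp only [spikeEntropy, mul_div_cancel₀ _ hq]

theorem energy_spike {q : ℕ} (i : Fin q) (w : ℝ) :
    energy (spike q i w) = -(1 / 2) * ((1 + ((q : ℝ) - 1) * w ^ 2) / q) := by
  rw [energy, sum_spike_mul_self]

theorem spikeEntropy_zero (q : ℕ) : spikeEntropy q 0 = 0 := by simp [spikeEntropy]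

/-! ### Shape of the canonical equilibrium macrostates -/

theorem freeEnergy_eq_sum {q : ℕ} (β : ℝ) (ν : Fin q → ℝ) :
    relEntropy ν - β / 2 * ∑ i, ν i * ν i = ∑ i, siteEnergy q β (ν i) := by
  simp [relEntropy, siteEnergy, Finset.mul_sum]

theorem continuous_siteEnergy (q : ℕ) (β : ℝ) : Continuous (siteEnergy q β) := by
  rcases Nat.eq_zero_or_pos q with rfl | hq
  · unfold siteEnergy
    simp only [Nat.cast_zero, zero_mul, Real.log_zero, mul_zero]
    fun_prop
  · have hq' : (q : ℝ) ≠ 0 := by exact_mod_cast hq.ne'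
    have h : siteEnergy q β =
        fun x => (1 / (q : ℝ)) * ((q * x) * Real.log (q * x)) - β / 2 * (x * x) := by
      funext x
      unfold siteEnergy
      field_simp
    rw [h]
    have h2 : Continuous fun x : ℝ => (q * x) * Real.log (q * x) :=
      Real.continuous_mul_log.comp (continuous_const.mul continuous_id)
    fun_prop

theorem isCompact_probVec (q : ℕ) : IsCompact (probVec q) := by
  have h : probVec q = stdSimplex ℝ (Fin q) := rfl
  rw [h]
  exact isCompact_stdSimplex ℝ (Fin q)

theorem canonicalEq_nonempty {q : ℕ} (hq : 0 < q) (β : ℝ) : (canonicalEq q β).Nonempty := by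
  have hc : Continuous fun ν : Fin q → ℝ => ∑ i, siteEnergy q β (ν i) :=
    continuous_finsetSum _ fun i _ => (continuous_siteEnergy q β).comp (continuous_apply i)
  obtain ⟨ν, hν, hmin⟩ := (isCompact_probVec q).exists_isMinOn
    ⟨_, spike_mem_probVec ⟨0, hq⟩ le_rfl zero_le_one⟩ hc.continuousOn
  refine ⟨ν, hν, fun μ hμ => ?_⟩
  rw [freeEnergy_eq_sum, freeEnergy_eq_sum]
  exact hmin hμ

theorem canonicalEq_exchange {q : ℕ} {β : ℝ} {ν : Fin q → ℝ} (hν : ν ∈ canonicalEq q β)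
    {i j : Fin q} (hij : i ≠ j) {t : ℝ} (ht : t ∈ Set.Icc (-ν i) (ν j)) :
    siteEnergy q β (ν i) + siteEnergy q β (ν j) ≤
      siteEnergy q β (ν i + t) + siteEnergy q β (ν j - t) := by
  set μ : Fin q → ℝ := Function.update (Function.update ν i (ν i + t)) j (ν j - t) with hμ
  have hsum : ∀ f : ℝ → ℝ, ∀ η : Fin q → ℝ, ∑ k, f (η k) =
      f (η i) + f (η j) + ∑ k ∈ (Finset.univ.erase i).erase j, f (η k) := fun f η => by
    rw [add_assoc, Finset.add_sum_erase _ (fun k => f (η k)) (by simp [hij.symm]),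
      Finset.add_sum_erase _ (fun k => f (η k)) (Finset.mem_univ i)]
  have hi : μ i = ν i + t := by simp [hμ, hij]
  have hj : μ j = ν j - t := by simp [hμ]
  have hk : ∀ k, k ≠ i → k ≠ j → μ k = ν k := fun k h1 h2 => by simp [hμ, h1, h2]
  have hrest : ∀ f : ℝ → ℝ, ∑ k ∈ (Finset.univ.erase i).erase j, f (μ k) =
      ∑ k ∈ (Finset.univ.erase i).erase j, f (ν k) := fun f =>
    Finset.sum_congr rfl fun k h => by
      simp only [Finset.mem_erase] at h
      rw [hk k h.2.1 h.1]
  have hmem : μ ∈ probVec q := by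
    constructor
    · intro k
      by_cases h1 : k = i
      · rw [h1, hi]; linarith [ht.1]
      by_cases h2 : k = j
      · rw [h2, hj]; linarith [ht.2]
      rw [hk k h1 h2]
      exact hν.1.1 k
    · have h1 := hsum (fun x => x) μ
      have h2 := hsum (fun x => x) ν
      have h3 := hν.1.2
      have h4 := hrest fun x => x
      rw [h1, h4, hi, hj]
      linarith
  have h := hν.2 μ hmem
  rw [freeEnergy_eq_sum, freeEnergy_eq_sum, hsum, hsum _ μ, hrest, hi, hj] at h
  linarith

/-- All entries are positive and share one Lagrange multiplier. Two entries at or above `1/β`, one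
of them strictly above, would be equal and could be spread apart, so at most one exceeds `1/β` and
the others coincide. -/
theorem canonicalEq_exists_spike {q : ℕ} {β : ℝ} (hβ : 0 < β)
    {ν : Fin q → ℝ} (hν : ν ∈ canonicalEq q β) :
    ∃ i w, 0 ≤ w ∧ w < 1 ∧ ν = spike q i w := by
  obtain ⟨i₀, hi₀⟩ : ∃ i, 0 < ν i := by
    by_contra! h
    have h1 : ∑ i, ν i ≤ 0 := Finset.sum_nonpos fun i _ => h i
    rw [hν.1.2] at h1
    linarith
  have hq : 0 < q := i₀.pos
  have hq' : (0 : ℝ) < q := by exact_mod_cast hq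
  have hpos : ∀ i, 0 < ν i := by
    intro i
    refine lt_of_le_of_ne (hν.1.1 i) fun h0 => ?_
    obtain ⟨t, ht, hlt⟩ := siteEnergy_exchange_pos hq hβ hi₀
    have hne : i ≠ i₀ := by rintro rfl; exact hi₀.ne h0
    have := canonicalEq_exchange hν hne (t := t) (by rwa [← h0, neg_zero])
    rw [← h0, zero_add] at this
    have h00 : siteEnergy q β 0 = 0 := by simp [siteEnergy]
    linarith
  have hK : ∀ i j, Real.log (ν i) - β * ν i = Real.log (ν j) - β * ν j := by
    intro i j
    by_cases hij : i = j
    · rw [hij]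
    · exact siteEnergy_deriv_eq hq (hpos i) (hpos j) fun t ht => canonicalEq_exchange hν hij ht
  have hsmall : ∀ i j, ν i ≤ 1 / β → ν j ≤ 1 / β → ν i = ν j := fun i j h1 h2 =>
    (strictMonoOn_log_sub_mul hβ).injOn ⟨hpos i, h1⟩ ⟨hpos j, h2⟩ (hK i j)
  have hlarge : ∀ i j, 1 / β ≤ ν i → 1 / β ≤ ν j → ν i = ν j := fun i j h1 h2 =>
    (strictAntiOn_log_sub_mul hβ).injOn h1 h2 (hK i j)
  by_cases hall : ∀ i, ν i ≤ 1 / β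
  · refine ⟨i₀, 0, le_rfl, zero_lt_one, ?_⟩
    rw [← rho_eq_spike]
    have hs := hν.1.2
    rw [Finset.sum_congr rfl fun j _ => hsmall j i₀ (hall j) (hall i₀)] at hs
    simp at hs
    funext j
    rw [hsmall j i₀ (hall j) (hall i₀), rho, eq_div_iff hq'.ne']
    linarith
  · push Not at hall
    obtain ⟨i, hi⟩ := hall
    have hlt : ∀ j, j ≠ i → ν j < 1 / β := by
      intro j hj
      by_contra! h
      obtain ⟨t, ht, hlt⟩ := siteEnergy_exchange_large hq hβ hi
      have he := hlarge j i h hi.le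
      have := canonicalEq_exchange hν hj (t := t) (by rwa [he])
      rw [he] at this
      linarith
    by_cases hex : ∃ j, j ≠ i
    · obtain ⟨j, hj⟩ := hex
      have heq : ν = fun k => if k = i then ν i else ν j := by
        funext k
        split_ifs with h
        · rw [h]
        · exact hsmall k j (hlt k h).le (hlt j hj).le
      have hs := hν.1.2
      rw [heq, show (∑ k, if k = i then ν i else ν j) = _ from
        sum_comp_ite (fun x => x) i _ _] at hs
      have hji : ν j < ν i := (hlt j hj).trans hi
      -- This `w` solves `(1 - w) / q = ν j`.
      refine ⟨i, 1 - q * ν j, by linarith, by linarith [mul_pos hq' (hpos j)], ?_⟩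
      rw [heq]
      funext k
      unfold spike
      split_ifs
      · rw [eq_div_iff hq'.ne']
        simp only [hj, if_false]
        linear_combination (q : ℝ) * hs
      · simp only [hj, if_false]
        field_simp
        ring
    -- Here `q = 1`.
    · push Not at hex
      have hs := hν.1.2
      have heq : ν = fun k => if k = i then ν i else ν i := by
        funext k; simp [hex k]
      rw [heq, show (∑ k, if k = i then ν i else ν i) = _ from
        sum_comp_ite (fun x => x) i _ _] at hs
      refine ⟨i, 0, le_rfl, zero_lt_one, ?_⟩
      rw [← rho_eq_spike]
      funext k
      rw [hex k, rho, eq_div_iff hq'.ne']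
      linarith

/-! ### The one-dimensional free energy -/

/-- `log ((1 + (q-1) w) / (1 - w))`, a multiple of the derivative of `spikeEntropy q`. -/
noncomputable def meanField (q : ℕ) (w : ℝ) : ℝ :=
  Real.log (1 + ((q : ℝ) - 1) * w) - Real.log (1 - w)

/-- The canonical free energy of `spike q i w`, up to a constant. -/
noncomputable def spikeFreeEnergy (q : ℕ) (β w : ℝ) : ℝ :=
  spikeEntropy q w - β / 2 * (((q : ℝ) - 1) / q * w ^ 2)

/-- The order parameter of the ordered phase at the critical inverse temperature. -/
noncomputable def wCrit (q : ℕ) : ℝ := ((q : ℝ) - 2) / ((q : ℝ) - 1)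

theorem spikeFreeEnergy_zero (q : ℕ) (β : ℝ) : spikeFreeEnergy q β 0 = 0 := by
  simp [spikeFreeEnergy, spikeEntropy_zero]

theorem three_le_cast {q : ℕ} (hq : 3 ≤ q) : (3 : ℝ) ≤ q := by exact_mod_cast hq

theorem wCrit_pos {q : ℕ} (hq : 3 ≤ q) : 0 < wCrit q := by
  have := three_le_cast hq
  exact div_pos (by linarith) (by linarith)

theorem wCrit_lt_one {q : ℕ} (hq : 3 ≤ q) : wCrit q < 1 := by
  have := three_le_cast hq
  rw [wCrit, div_lt_one (by linarith)]
  linarith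

theorem betaC_pos {q : ℕ} (hq : 3 ≤ q) : 0 < betaC q := by
  have := three_le_cast hq
  have h := Real.log_pos (by linarith : 1 < (q : ℝ) - 1)
  exact mul_pos (div_pos (by linarith) (by linarith)) h

theorem one_add_mul_pos {q : ℕ} (hq : 3 ≤ q) {w : ℝ} (hw : 0 ≤ w) : 0 < 1 + ((q : ℝ) - 1) * w := by
  have := three_le_cast hq
  have := mul_nonneg (by linarith : 0 ≤ (q : ℝ) - 1) hw
  linarith

theorem hasDerivAt_meanField {q : ℕ} (hq : 3 ≤ q) {w : ℝ} (h0 : 0 ≤ w) (h1 : w < 1) :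
    HasDerivAt (meanField q) (q / ((1 + ((q : ℝ) - 1) * w) * (1 - w))) w := by
  have hp := one_add_mul_pos hq h0
  have hm : 0 < 1 - w := by linarith
  have d1 : HasDerivAt (fun w : ℝ => 1 + ((q : ℝ) - 1) * w) ((q : ℝ) - 1) w := by
    simpa using ((hasDerivAt_id' w).const_mul ((q : ℝ) - 1)).const_add 1
  have d2 : HasDerivAt (fun w : ℝ => 1 - w) (-1) w := (hasDerivAt_id' w).const_sub 1
  have h : HasDerivAt (meanField q) _ w := (d1.log hp.ne').sub (d2.log hm.ne')
  refine h.congr_deriv ?_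
  field_simp
  ring

theorem hasDerivAt_spikeEntropy {q : ℕ} (hq : 3 ≤ q) {w : ℝ} (h0 : 0 ≤ w) (h1 : w < 1) :
    HasDerivAt (spikeEntropy q) (((q : ℝ) - 1) / q * meanField q w) w := by
  have hp := one_add_mul_pos hq h0
  have hm : 0 < 1 - w := by linarith
  have := three_le_cast hq
  have d1 : HasDerivAt (fun w : ℝ => 1 + ((q : ℝ) - 1) * w) ((q : ℝ) - 1) w := by
    simpa using ((hasDerivAt_id' w).const_mul ((q : ℝ) - 1)).const_add 1
  have d2 : HasDerivAt (fun w : ℝ => 1 - w) (-1) w := (hasDerivAt_id' w).const_sub 1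
  have h : HasDerivAt (spikeEntropy q) _ w :=
    ((d1.div_const (q : ℝ)).mul (d1.log hp.ne')).add
      (((d2.div_const (q : ℝ)).mul (d2.log hm.ne')).const_mul ((q : ℝ) - 1))
  refine h.congr_deriv ?_
  unfold meanField
  field_simp
  ring

theorem hasDerivAt_spikeFreeEnergy {q : ℕ} (hq : 3 ≤ q) (β : ℝ) {w : ℝ} (h0 : 0 ≤ w) (h1 : w < 1) :
    HasDerivAt (spikeFreeEnergy q β) (((q : ℝ) - 1) / q * (meanField q w - β * w)) w := by
  have h : HasDerivAt (spikeFreeEnergy q β) _ w :=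
    (hasDerivAt_spikeEntropy hq h0 h1).sub
      ((((hasDerivAt_id' w).pow 2).const_mul (((q : ℝ) - 1) / q)).const_mul (β / 2))
  refine h.congr_deriv ?_
  simp
  ring

/-- At `wCrit q` the ratio under the logarithm is `(q - 1)^2`, at `wCrit q / 2` it is `q - 1`, and
`betaC q * wCrit q = 2 log (q - 1)`. -/
theorem meanField_wCrit {q : ℕ} (hq : 3 ≤ q) : meanField q (wCrit q) = betaC q * wCrit q := by
  have := three_le_cast hq
  have h1 : 1 + ((q : ℝ) - 1) * wCrit q = (q : ℝ) - 1 := by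
    rw [wCrit, mul_div_cancel₀ _ (by linarith)]; ring
  have h2 : 1 - wCrit q = ((q : ℝ) - 1)⁻¹ := by
    have : (q : ℝ) - 1 ≠ 0 := by linarith
    rw [wCrit]; field_simp; ring
  rw [meanField, h1, h2, Real.log_inv, betaC, wCrit]
  have : (q : ℝ) - 1 ≠ 0 := by linarith
  have : (q : ℝ) - 2 ≠ 0 := by linarith
  field_simp
  ring

theorem meanField_half_wCrit {q : ℕ} (hq : 3 ≤ q) :
    meanField q (wCrit q / 2) = betaC q * (wCrit q / 2) := by
  have := three_le_cast hq
  have hp1 : (q : ℝ) - 1 ≠ 0 := by linarith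
  have hp2 : (q : ℝ) - 2 ≠ 0 := by linarith
  have hq0 : (q : ℝ) ≠ 0 := by linarith
  have h1 : 1 + ((q : ℝ) - 1) * (wCrit q / 2) = ((q : ℝ) - 1) * (1 - wCrit q / 2) := by
    rw [wCrit]; field_simp; ring
  have h2 : 1 - wCrit q / 2 ≠ 0 := by linarith [wCrit_lt_one hq, wCrit_pos hq]
  rw [meanField, h1, Real.log_mul hp1 h2, betaC, wCrit]
  field_simp
  ring

/-- Coexistence: at `betaC q` the ordered phase ties with `rho q`, both terms being `(q - 2) / q *
log (q - 1)`. -/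
theorem spikeFreeEnergy_betaC_wCrit {q : ℕ} (hq : 3 ≤ q) :
    spikeFreeEnergy q (betaC q) (wCrit q) = 0 := by
  have := three_le_cast hq
  have hp1 : (q : ℝ) - 1 ≠ 0 := by linarith
  have hp2 : (q : ℝ) - 2 ≠ 0 := by linarith
  have hq0 : (q : ℝ) ≠ 0 := by linarith
  have h1 : 1 + ((q : ℝ) - 1) * wCrit q = (q : ℝ) - 1 := by
    rw [wCrit, mul_div_cancel₀ _ hp1]; ring
  have h2 : 1 - wCrit q = ((q : ℝ) - 1)⁻¹ := by
    rw [wCrit]; field_simp; ring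
  rw [spikeFreeEnergy, spikeEntropy, h1, h2, Real.log_inv, betaC, wCrit]
  field_simp
  ring

/-- The derivative is `q` over a downward parabola with vertex `wCrit q / 2`, so it decreases up to
the vertex and increases after it. -/
theorem strictConcaveOn_meanField {q : ℕ} (hq : 3 ≤ q) :
    StrictConcaveOn ℝ (Set.Icc 0 (wCrit q / 2)) (meanField q) := by
  have hc := wCrit_lt_one hq
  have hc0 := wCrit_pos hq
  have h3 := three_le_cast hq
  have hmul : ((q : ℝ) - 1) * wCrit q = q - 2 := mul_div_cancel₀ _ (by linarith)
  refine StrictAntiOn.strictConcaveOn_of_deriv (convex_Icc _ _) (fun w hw =>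
    (hasDerivAt_meanField hq hw.1 (by linarith [hw.2])).continuousAt.continuousWithinAt) ?_
  rw [interior_Icc]
  intro x hx y hy hxy
  obtain ⟨hx0, hx1⟩ := hx
  obtain ⟨hy0, hy1⟩ := hy
  rw [(hasDerivAt_meanField hq hx0.le (by linarith)).deriv,
    (hasDerivAt_meanField hq hy0.le (by linarith)).deriv]
  refine div_lt_div_of_pos_left (by linarith)
    (mul_pos (one_add_mul_pos hq hx0.le) (by linarith)) ?_
  -- The difference of the two denominators, in factored form.
  have : 0 < (y - x) * (((q : ℝ) - 1) * (wCrit q - x - y)) :=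
    mul_pos (by linarith) (mul_pos (by linarith) (by linarith))
  nlinarith

theorem strictConvexOn_meanField {q : ℕ} (hq : 3 ≤ q) :
    StrictConvexOn ℝ (Set.Ico (wCrit q / 2) 1) (meanField q) := by
  have hc := wCrit_lt_one hq
  have hc0 := wCrit_pos hq
  have h3 := three_le_cast hq
  have hmul : ((q : ℝ) - 1) * wCrit q = q - 2 := mul_div_cancel₀ _ (by linarith)
  refine StrictMonoOn.strictConvexOn_of_deriv (convex_Ico _ _) (fun w hw =>
    (hasDerivAt_meanField hq (by linarith [hw.1]) hw.2).continuousAt.continuousWithinAt) ?_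
  rw [interior_Ico]
  intro x hx y hy hxy
  obtain ⟨hx0, hx1⟩ := hx
  obtain ⟨hy0, hy1⟩ := hy
  rw [(hasDerivAt_meanField hq (by linarith) hx1).deriv,
    (hasDerivAt_meanField hq (by linarith) hy1).deriv]
  refine div_lt_div_of_pos_left (by linarith)
    (mul_pos (one_add_mul_pos hq (by linarith)) (by linarith)) ?_
  have : 0 < (y - x) * (((q : ℝ) - 1) * (x + y - wCrit q)) :=
    mul_pos (by linarith) (mul_pos (by linarith) (by linarith))
  nlinarith

theorem betaC_mul_lt_meanField_of_lt_half {q : ℕ} (hq : 3 ≤ q) {w : ℝ} (h0 : 0 < w)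
    (h1 : w < wCrit q / 2) :
    betaC q * w < meanField q w := by
  have hc0 := wCrit_pos hq
  have h := (strictConcaveOn_meanField hq).secant_strict_mono (a := 0) (x := w) (y := wCrit q / 2)
    ⟨le_rfl, by linarith⟩ ⟨h0.le, h1.le⟩ ⟨by linarith, le_rfl⟩ h0.ne' (by linarith) h1
  have hz : meanField q 0 = 0 := by simp [meanField]
  rwa [hz, sub_zero, sub_zero, sub_zero, sub_zero, meanField_half_wCrit hq,
    mul_div_cancel_right₀ _ (by linarith), lt_div_iff₀ h0] at h

theorem meanField_lt_betaC_mul {q : ℕ} (hq : 3 ≤ q) {w : ℝ} (h0 : wCrit q / 2 < w)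
    (h1 : w < wCrit q) :
    meanField q w < betaC q * w := by
  have hc0 := wCrit_pos hq
  have hc := wCrit_lt_one hq
  have h := (strictConvexOn_meanField hq).secant_strict_mono (a := wCrit q / 2) (x := w)
    (y := wCrit q) ⟨le_rfl, by linarith⟩ ⟨h0.le, by linarith⟩ ⟨by linarith, hc⟩ h0.ne'
    (by linarith) h1
  rw [meanField_half_wCrit hq, meanField_wCrit hq, ← mul_sub,
    mul_div_cancel_right₀ _ (by linarith), div_lt_iff₀ (by linarith)] at h
  linarith

theorem betaC_lt_secant {q : ℕ} (hq : 3 ≤ q) {w : ℝ} (h0 : wCrit q < w) (h1 : w < 1) :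
    betaC q < (meanField q w - meanField q (wCrit q / 2)) / (w - wCrit q / 2) := by
  have hc0 := wCrit_pos hq
  have h := (strictConvexOn_meanField hq).secant_strict_mono (a := wCrit q / 2) (x := wCrit q)
    (y := w) ⟨le_rfl, by linarith⟩ ⟨by linarith, by linarith⟩ ⟨by linarith, h1⟩ (by linarith)
    (by linarith) h0
  rwa [meanField_half_wCrit hq, meanField_wCrit hq, ← mul_sub,
    mul_div_cancel_right₀ _ (by linarith), ← meanField_half_wCrit hq] at h

theorem betaC_mul_lt_meanField {q : ℕ} (hq : 3 ≤ q) {w : ℝ} (h0 : wCrit q < w) (h1 : w < 1) :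
    betaC q * w < meanField q w := by
  have hc0 := wCrit_pos hq
  have h := betaC_lt_secant hq h0 h1
  rw [lt_div_iff₀ (by linarith), meanField_half_wCrit hq] at h
  linarith

/-- With `c = wCrit q / 2` and `m` the secant slope from `c`, the quotient is `m - (m - betaC q) * c
/ w`. Since `m` increases by convexity and exceeds `betaC q`, so does the quotient increase. -/
theorem strictMonoOn_meanField_div {q : ℕ} (hq : 3 ≤ q) :
    StrictMonoOn (fun w => meanField q w / w) (Set.Ioo (wCrit q) 1) := by
  have hc0 := wCrit_pos hq
  intro a ha b hb hab
  have h1 := betaC_lt_secant hq ha.1 ha.2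
  have h2 := (strictConvexOn_meanField hq).secant_strict_mono (a := wCrit q / 2) (x := a)
    (y := b) ⟨le_rfl, by linarith [ha.1, ha.2]⟩ ⟨by linarith [ha.1], ha.2⟩
    ⟨by linarith [hb.1], hb.2⟩ (by linarith [ha.1]) (by linarith [hb.1]) hab
  have hA : meanField q a = betaC q * (wCrit q / 2) +
      (meanField q a - meanField q (wCrit q / 2)) / (a - wCrit q / 2) * (a - wCrit q / 2) := by
    rw [div_mul_cancel₀ _ (by linarith [ha.1]), meanField_half_wCrit hq]
    ring
  rw [lt_div_iff₀ (by linarith [hb.1])] at h2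
  set m := (meanField q a - meanField q (wCrit q / 2)) / (a - wCrit q / 2)
  have ha0 : 0 < a := by linarith [ha.1]
  have hb0 : 0 < b := by linarith
  have h3 : 0 < (m - betaC q) * (wCrit q / 2) * (b - a) :=
    mul_pos (mul_pos (by linarith) (by linarith)) (by linarith)
  have h4 := mul_lt_mul_of_pos_right h2 ha0
  simp only
  rw [div_lt_div_iff₀ ha0 hb0, hA]
  rw [meanField_half_wCrit hq] at h4
  nlinarith

/-- A double well: the function rises from `0`, falls back to `0` at `wCrit q`, then rises again. -/
theorem spikeFreeEnergy_betaC_pos {q : ℕ} (hq : 3 ≤ q) {w : ℝ} (h0 : 0 < w) (h1 : w < 1)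
    (hw : w ≠ wCrit q) :
    0 < spikeFreeEnergy q (betaC q) w := by
  have hc0 := wCrit_pos hq
  have hc := wCrit_lt_one hq
  have h3 := three_le_cast hq
  have hk : 0 < ((q : ℝ) - 1) / q := div_pos (by linarith) (by linarith)
  have hd := fun x (hx : 0 ≤ x) (hx1 : x < 1) => hasDerivAt_spikeFreeEnergy hq (betaC q) hx hx1
  rcases le_or_gt w (wCrit q / 2) with hlt | hgt
  · have hmono : StrictMonoOn (spikeFreeEnergy q (betaC q)) (Set.Icc 0 (wCrit q / 2)) := by
      refine strictMonoOn_of_deriv_pos (convex_Icc _ _) (fun x hx =>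
        (hd x hx.1 (by linarith [hx.2])).continuousAt.continuousWithinAt) fun x hx => ?_
      rw [interior_Icc] at hx
      rw [(hd x hx.1.le (by linarith [hx.2])).deriv]
      exact mul_pos hk (sub_pos.2 (betaC_mul_lt_meanField_of_lt_half hq hx.1 hx.2))
    have := hmono ⟨le_rfl, by linarith⟩ ⟨h0.le, hlt⟩ h0
    rwa [spikeFreeEnergy_zero] at this
  rcases lt_or_gt_of_ne hw with hlt | hgt'
  · have hanti : StrictAntiOn (spikeFreeEnergy q (betaC q)) (Set.Icc (wCrit q / 2) (wCrit q)) := by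
      refine strictAntiOn_of_deriv_neg (convex_Icc _ _) (fun x hx =>
        (hd x (by linarith [hx.1]) (by linarith [hx.2])).continuousAt.continuousWithinAt)
        fun x hx => ?_
      rw [interior_Icc] at hx
      rw [(hd x (by linarith [hx.1]) (by linarith [hx.2])).deriv]
      exact mul_neg_of_pos_of_neg hk (sub_neg.2 (meanField_lt_betaC_mul hq hx.1 hx.2))
    have := hanti ⟨hgt.le, hlt.le⟩ ⟨by linarith, le_rfl⟩ hlt
    rwa [spikeFreeEnergy_betaC_wCrit hq] at this
  · have hmono : StrictMonoOn (spikeFreeEnergy q (betaC q)) (Set.Ico (wCrit q) 1) := by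
      refine strictMonoOn_of_deriv_pos (convex_Ico _ _) (fun x hx =>
        (hd x (by linarith [hx.1]) hx.2).continuousAt.continuousWithinAt) fun x hx => ?_
      rw [interior_Ico] at hx
      rw [(hd x (by linarith [hx.1]) hx.2).deriv]
      exact mul_pos hk (sub_pos.2 (betaC_mul_lt_meanField hq hx.1 hx.2))
    have := hmono ⟨le_rfl, hc⟩ ⟨hgt'.le, h1⟩ hgt'
    rwa [spikeFreeEnergy_betaC_wCrit hq] at this

theorem spikeFreeEnergy_betaC_nonneg {q : ℕ} (hq : 3 ≤ q) {w : ℝ} (h0 : 0 ≤ w) (h1 : w < 1) :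
    0 ≤ spikeFreeEnergy q (betaC q) w := by
  rcases h0.eq_or_lt with rfl | h0
  · rw [spikeFreeEnergy_zero]
  by_cases hw : w = wCrit q
  · rw [hw, spikeFreeEnergy_betaC_wCrit hq]
  · exact (spikeFreeEnergy_betaC_pos hq h0 h1 hw).le

/-! ### The mean-field equation as stationarity -/

theorem mem_wSolutions_iff {q : ℕ} (hq : 3 ≤ q) {β w : ℝ} (h0 : 0 ≤ w) (h1 : w < 1) :
    w ∈ wSolutions q β ↔ meanField q w = β * w := by
  have hp := one_add_mul_pos hq h0
  have hm : 0 < 1 - w := by linarith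
  have h3 := three_le_cast hq
  have he := Real.exp_pos (-β * w)
  have hden : 0 < 1 + ((q : ℝ) - 1) * Real.exp (-β * w) := by
    have := mul_pos (by linarith : 0 < (q : ℝ) - 1) he
    linarith
  have h2 : meanField q w = β * w ↔
      Real.log ((1 - w) / (1 + ((q : ℝ) - 1) * w)) = -β * w := by
    rw [meanField, Real.log_div hm.ne' hp.ne']
    constructor <;> intro h <;> linarith
  rw [h2, ← Real.exp_eq_exp, Real.exp_log (div_pos hm hp), div_eq_iff hp.ne', wSolutions,
    Set.mem_ofPred_eq, eq_div_iff hden.ne']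
  constructor <;> intro h <;> linarith

theorem wOf_lt_one {q : ℕ} (hq : 3 ≤ q) (β : ℝ) : wOf q β < 1 := by
  have h := (isGreatest_wOf (by lia : 1 ≤ q) β).1
  have h3 := three_le_cast hq
  rw [wSolutions, Set.mem_ofPred_eq] at h
  have he := Real.exp_pos (-β * wOf q β)
  have hpe := mul_pos (by linarith : 0 < (q : ℝ) - 1) he
  rw [h, div_lt_one (by linarith)]
  linarith

/-- The largest root also lies above `wCrit q`, where `meanField q w / w` is injective. -/
theorem eq_wOf {q : ℕ} (hq : 3 ≤ q) {β w : ℝ} (h0 : wCrit q < w) (h1 : w < 1)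
    (h : meanField q w = β * w) :
    w = wOf q β := by
  have hc0 := wCrit_pos hq
  have hg := isGreatest_wOf (by lia : 1 ≤ q) β
  have hle : w ≤ wOf q β := hg.2 ((mem_wSolutions_iff hq (by linarith) h1).2 h)
  have hlt := wOf_lt_one hq β
  have h2 := (mem_wSolutions_iff hq (by linarith) hlt).1 hg.1
  refine (strictMonoOn_meanField_div hq).injOn ⟨h0, h1⟩ ⟨by linarith, hlt⟩ ?_
  rw [h, h2, mul_div_cancel_right₀ _ (by linarith), mul_div_cancel_right₀ _ (by linarith)]

/-! ### Canonical equilibrium macrostates -/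

theorem freeEnergy_spike {q : ℕ} (β : ℝ) (i : Fin q) (w : ℝ) :
    relEntropy (spike q i w) - β / 2 * ∑ j, spike q i w j * spike q i w j =
      spikeFreeEnergy q β w - β / (2 * q) := by
  have hq : (0 : ℝ) < q := by exact_mod_cast i.pos
  rw [relEntropy_spike, sum_spike_mul_self, spikeFreeEnergy]
  field_simp
  ring

/-- By compactness some minimizer exists, and it is a spike; the free energy of a spike does not
depend on its site. -/
theorem spike_mem_canonicalEq {q : ℕ} {β : ℝ} (hβ : 0 < β) (i : Fin q) {w : ℝ} (h0 : 0 ≤ w)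
    (h1 : w < 1) (h : ∀ x, 0 ≤ x → x < 1 → spikeFreeEnergy q β w ≤ spikeFreeEnergy q β x) :
    spike q i w ∈ canonicalEq q β := by
  obtain ⟨ν, hν⟩ := canonicalEq_nonempty i.pos β
  obtain ⟨j, x, hx0, hx1, rfl⟩ := canonicalEq_exists_spike hβ hν
  refine ⟨spike_mem_probVec i h0 h1.le, fun μ hμ => le_trans ?_ (hν.2 μ hμ)⟩
  rw [freeEnergy_spike, freeEnergy_spike]
  linarith [h x hx0 hx1]

theorem spikeFreeEnergy_le_of_mem {q : ℕ} {β : ℝ} {i : Fin q} {w : ℝ}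
    (h : spike q i w ∈ canonicalEq q β) {x : ℝ} (h0 : 0 ≤ x) (h1 : x ≤ 1) :
    spikeFreeEnergy q β w ≤ spikeFreeEnergy q β x := by
  have := h.2 _ (spike_mem_probVec i h0 h1)
  rw [freeEnergy_spike, freeEnergy_spike] at this
  linarith

theorem rho_mem_canonicalEq_betaC {q : ℕ} (hq : 3 ≤ q) : rho q ∈ canonicalEq q (betaC q) := by
  rw [rho_eq_spike ⟨0, by lia⟩]
  refine spike_mem_canonicalEq (betaC_pos hq) _ le_rfl zero_lt_one fun x h0 h1 => ?_
  rw [spikeFreeEnergy_zero]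
  exact spikeFreeEnergy_betaC_nonneg hq h0 h1

theorem spike_wCrit_mem_canonicalEq {q : ℕ} (hq : 3 ≤ q) (i : Fin q) :
    spike q i (wCrit q) ∈ canonicalEq q (betaC q) := by
  refine spike_mem_canonicalEq (betaC_pos hq) _ (wCrit_pos hq).le (wCrit_lt_one hq)
    fun x h0 h1 => ?_
  rw [spikeFreeEnergy_betaC_wCrit hq]
  exact spikeFreeEnergy_betaC_nonneg hq h0 h1

theorem eq_spike_of_mem_canonicalEq_betaC {q : ℕ} (hq : 3 ≤ q) {ν : Fin q → ℝ}
    (h : ν ∈ canonicalEq q (betaC q)) : ∃ i, ν = spike q i 0 ∨ ν = spike q i (wCrit q) := by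
  obtain ⟨i, w, h0, h1, rfl⟩ := canonicalEq_exists_spike (betaC_pos hq) h
  refine ⟨i, ?_⟩
  have hle := spikeFreeEnergy_le_of_mem h le_rfl zero_le_one
  rw [spikeFreeEnergy_zero] at hle
  rcases h0.eq_or_lt with rfl | h0
  · exact Or.inl rfl
  · refine Or.inr ?_
    by_contra hne
    exact hle.not_gt (spikeFreeEnergy_betaC_pos hq h0 h1 fun hw => hne (by rw [hw]))

/-- Since `w` does at least as well as `wCrit q` at `β` but no better at `betaC q`, `w ≥ wCrit q`.
It is then an interior stationary point, and `wCrit q` is stationary only for `betaC q`. -/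
theorem eq_spike_wOf_of_mem_canonicalEq {q : ℕ} (hq : 3 ≤ q) {β : ℝ} (hβ : betaC q < β)
    {ν : Fin q → ℝ} (h : ν ∈ canonicalEq q β) :
    wCrit q < wOf q β ∧ meanField q (wOf q β) = β * wOf q β ∧ ∃ i, ν = spike q i (wOf q β) := by
  have hc0 := wCrit_pos hq
  have h3 := three_le_cast hq
  have hk : 0 < ((q : ℝ) - 1) / q := div_pos (by linarith) (by linarith)
  obtain ⟨i, w, h0, h1, rfl⟩ := canonicalEq_exists_spike ((betaC_pos hq).trans hβ) h
  have hle := spikeFreeEnergy_le_of_mem h hc0.le (wCrit_lt_one hq).le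
  have hn := spikeFreeEnergy_betaC_nonneg hq h0 h1
  have hz := spikeFreeEnergy_betaC_wCrit hq
  have hsq : wCrit q ^ 2 ≤ w ^ 2 := by
    unfold spikeFreeEnergy at hle hn hz
    have : 0 ≤ (β - betaC q) * (((q : ℝ) - 1) / q) * (w ^ 2 - wCrit q ^ 2) := by linarith
    have := nonneg_of_mul_nonneg_right this (mul_pos (sub_pos.2 hβ) hk)
    linarith
  have hcw : wCrit q ≤ w := (sq_le_sq₀ hc0.le h0).1 hsq
  have hloc : IsLocalMin (spikeFreeEnergy q β) w := by
    filter_upwards [Icc_mem_nhds (by linarith : 0 < w) h1] with x hx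
    exact spikeFreeEnergy_le_of_mem h hx.1 hx.2
  have hcrit := hloc.hasDerivAt_eq_zero (hasDerivAt_spikeFreeEnergy hq β h0 h1)
  have hmf : meanField q w = β * w := by
    rcases mul_eq_zero.1 hcrit with h | h
    · exact absurd h hk.ne'
    · linarith
  have hlt : wCrit q < w := by
    refine lt_of_le_of_ne hcw fun he => ?_
    rw [← he, meanField_wCrit hq] at hmf
    exact hβ.ne (mul_right_cancel₀ hc0.ne' hmf)
  have hw := eq_wOf hq hlt h1 hmf
  rw [← hw]
  exact ⟨hlt, hmf, i, rfl⟩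

theorem wOf_spec {q : ℕ} (hq : 3 ≤ q) {β : ℝ} (hβ : betaC q < β) :
    wCrit q < wOf q β ∧ meanField q (wOf q β) = β * wOf q β :=
  let ⟨_, hν⟩ := canonicalEq_nonempty (by lia) β
  let h := eq_spike_wOf_of_mem_canonicalEq hq hβ hν
  ⟨h.1, h.2.1⟩

theorem one_div_le_sum_mul_self {q : ℕ} (hq : 0 < q) {ν : Fin q → ℝ} (hν : ν ∈ probVec q) :
    1 / (q : ℝ) ≤ ∑ i, ν i * ν i := by
  have hq' : (0 : ℝ) < q := by exact_mod_cast hq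
  have h := sq_sum_le_card_mul_sum_sq (s := Finset.univ) (f := ν)
  rw [hν.2, Finset.card_univ, Fintype.card_fin] at h
  simp only [pow_two] at h
  rw [div_le_iff₀ hq']
  linarith

theorem sum_rho_mul_self {q : ℕ} (hq : 0 < q) : ∑ i, rho q i * rho q i = 1 / (q : ℝ) := by
  rw [rho_eq_spike ⟨0, hq⟩, sum_spike_mul_self]
  simp

theorem energy_rho {q : ℕ} (hq : 0 < q) : energy (rho q) = uC q := by
  rw [energy, sum_rho_mul_self hq, uC]
  ring

theorem rho_mem_canonicalEq {q : ℕ} (hq : 3 ≤ q) {β : ℝ} (hβ : β ≤ betaC q) :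
    rho q ∈ canonicalEq q β := by
  have h := rho_mem_canonicalEq_betaC hq
  refine ⟨h.1, fun μ hμ => ?_⟩
  have h1 := h.2 μ hμ
  have h2 := one_div_le_sum_mul_self (by lia) hμ
  rw [sum_rho_mul_self (by lia)] at h1 ⊢
  nlinarith [mul_nonneg (sub_nonneg.2 hβ) (sub_nonneg.2 h2)]

/-- Lowering `β` from `betaC q` adds a positive multiple of `∑ i, ν i * ν i`, which `rho q`
minimizes. The sign of `β` plays no role, so `β ≤ 0` needs no spike analysis. -/
theorem energy_of_lt_betaC {q : ℕ} (hq : 3 ≤ q) {β : ℝ} (hβ : β < betaC q) {ν : Fin q → ℝ}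
    (hν : ν ∈ canonicalEq q β) : energy ν = uC q := by
  have h := rho_mem_canonicalEq_betaC hq
  have h1 := h.2 ν hν.1
  have h2 := one_div_le_sum_mul_self (by lia) hν.1
  have h3 := hν.2 _ h.1
  rw [sum_rho_mul_self (by lia)] at h1 h3
  have h4 : 0 ≤ (betaC q - β) * (1 / (q : ℝ) - ∑ i, ν i * ν i) := by linarith
  have h5 := nonneg_of_mul_nonneg_right h4 (sub_pos.2 hβ)
  rw [energy, le_antisymm (sub_nonneg.1 h5) h2, uC]
  ring

/-! ### Microcanonical equilibrium macrostates -/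

theorem microEq_eq_inter {q : ℕ} {β : ℝ} {ν : Fin q → ℝ} (hν : ν ∈ canonicalEq q β) :
    microEq q (energy ν) = canonicalEq q β ∩ {μ | energy μ = energy ν} := by
  have hs : ∀ μ : Fin q → ℝ, energy μ = energy ν → ∑ i, μ i * μ i = ∑ i, ν i * ν i :=
    fun μ h => by unfold energy at h; linarith
  ext μ
  constructor
  · rintro ⟨h1, h2, h3⟩
    refine ⟨⟨h1, fun η hη => le_trans ?_ (hν.2 η hη)⟩, h2⟩
    rw [hs μ h2]
    linarith [h3 ν hν.1 rfl]
  · rintro ⟨h1, h2⟩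
    refine ⟨h1.1, h2, fun η hη he => ?_⟩
    have := h1.2 η hη
    rw [hs μ h2, hs η he] at this
    linarith

theorem microEq_eq_of_forall {q : ℕ} {β u : ℝ} (hne : (canonicalEq q β).Nonempty)
    (h : ∀ ν ∈ canonicalEq q β, energy ν = u) : microEq q u = canonicalEq q β := by
  obtain ⟨ν, hν⟩ := hne
  rw [← h ν hν, microEq_eq_inter hν, Set.inter_eq_left]
  exact fun μ hμ => (h μ hμ).trans (h ν hν).symm

theorem microEntropy_of_mem {q : ℕ} {u : ℝ} {ν : Fin q → ℝ} (hν : ν ∈ microEq q u) :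
    microEntropy q u = ((-relEntropy ν : ℝ) : EReal) := by
  have h : IsLeast {r : EReal | ∃ ν ∈ probVec q, energy ν = u ∧ r = (relEntropy ν : EReal)}
      (relEntropy ν : EReal) := by
    refine ⟨⟨ν, hν.1, hν.2.1, rfl⟩, ?_⟩
    rintro _ ⟨μ, hμ, he, rfl⟩
    exact EReal.coe_le_coe_iff.2 (hν.2.2 μ hμ he)
  rw [microEntropy, h.isGLB.sInf_eq, EReal.coe_neg]

/-! ### The ordered branch parametrized by energy -/

/-- The energy of `spike q i w`. -/
noncomputable def spikeEnergy (q : ℕ) (w : ℝ) : ℝ := -(1 / 2) * ((1 + ((q : ℝ) - 1) * w ^ 2) / q)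

theorem energy_spike_eq_spikeEnergy {q : ℕ} (i : Fin q) (w : ℝ) :
    energy (spike q i w) = spikeEnergy q w := energy_spike i w

theorem spikeEnergy_zero (q : ℕ) : spikeEnergy q 0 = uC q := by
  rw [spikeEnergy, uC]
  ring

theorem spikeEnergy_wCrit {q : ℕ} (hq : 3 ≤ q) : spikeEnergy q (wCrit q) = uZero q := by
  have h3 := three_le_cast hq
  have : (q : ℝ) - 1 ≠ 0 := by linarith
  rw [spikeEnergy, uZero, wCrit]
  field_simp
  ring

theorem spikeEnergy_one {q : ℕ} (hq : 3 ≤ q) : spikeEnergy q 1 = -(1 / 2) := by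
  have h3 := three_le_cast hq
  rw [spikeEnergy]
  field_simp
  ring

theorem spikeEnergy_strictAntiOn {q : ℕ} (hq : 3 ≤ q) :
    StrictAntiOn (spikeEnergy q) (Set.Ici 0) := by
  have h3 := three_le_cast hq
  intro a ha b hb hab
  have hsq : a ^ 2 < b ^ 2 := pow_lt_pow_left₀ hab ha two_ne_zero
  have h : (1 + ((q : ℝ) - 1) * a ^ 2) / q < (1 + ((q : ℝ) - 1) * b ^ 2) / q := by
    apply div_lt_div_of_pos_right _ (by linarith)
    nlinarith
  unfold spikeEnergy
  linarith

/-- The nonnegative `w` for which `spike q i w` has energy `u`. -/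
noncomputable def wEnergy (q : ℕ) (u : ℝ) : ℝ := Real.sqrt ((-2 * q * u - 1) / ((q : ℝ) - 1))

theorem uZero_lt_uC {q : ℕ} (hq : 3 ≤ q) : uZero q < uC q := by
  rw [← spikeEnergy_wCrit hq, ← spikeEnergy_zero]
  exact spikeEnergy_strictAntiOn hq Set.self_mem_Ici (wCrit_pos hq).le (wCrit_pos hq)

theorem wEnergy_arg_pos {q : ℕ} (hq : 3 ≤ q) {u : ℝ} (hu : u < uZero q) :
    0 < (-2 * q * u - 1) / ((q : ℝ) - 1) := by
  have h3 := three_le_cast hq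
  have h := hu.trans (uZero_lt_uC hq)
  rw [uC, ← neg_div, lt_div_iff₀ (by linarith)] at h
  exact div_pos (by linarith) (by linarith)

theorem spikeEnergy_wEnergy {q : ℕ} (hq : 3 ≤ q) {u : ℝ} (hu : u < uZero q) :
    spikeEnergy q (wEnergy q u) = u := by
  have h3 := three_le_cast hq
  rw [spikeEnergy, wEnergy, Real.sq_sqrt (wEnergy_arg_pos hq hu).le,
    mul_div_cancel₀ _ (by linarith)]
  field_simp
  ring

theorem wEnergy_mem_Ioo {q : ℕ} (hq : 3 ≤ q) {u : ℝ} (hu : u ∈ Set.Ioo (-(1 / 2)) (uZero q)) :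
    wEnergy q u ∈ Set.Ioo (wCrit q) 1 := by
  have hs := spikeEnergy_wEnergy hq hu.2
  have ha := spikeEnergy_strictAntiOn hq
  have h0 : 0 ≤ wEnergy q u := Real.sqrt_nonneg _
  constructor
  · rw [← ha.lt_iff_gt h0 (wCrit_pos hq).le, hs, spikeEnergy_wCrit hq]
    exact hu.2
  · rw [← ha.lt_iff_gt (zero_le_one' ℝ) h0, hs, spikeEnergy_one hq]
    exact hu.1

/-- The inverse temperature of the equilibrium macrostates of energy `u`. -/
noncomputable def betaEnergy (q : ℕ) (u : ℝ) : ℝ := meanField q (wEnergy q u) / wEnergy q u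

theorem betaC_lt_betaEnergy {q : ℕ} (hq : 3 ≤ q) {u : ℝ}
    (hu : u ∈ Set.Ioo (-(1 / 2)) (uZero q)) : betaC q < betaEnergy q u := by
  obtain ⟨h1, h2⟩ := wEnergy_mem_Ioo hq hu
  rw [betaEnergy, lt_div_iff₀ ((wCrit_pos hq).trans h1)]
  exact betaC_mul_lt_meanField hq h1 h2

theorem wOf_betaEnergy {q : ℕ} (hq : 3 ≤ q) {u : ℝ}
    (hu : u ∈ Set.Ioo (-(1 / 2)) (uZero q)) : wOf q (betaEnergy q u) = wEnergy q u := by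
  obtain ⟨h1, h2⟩ := wEnergy_mem_Ioo hq hu
  refine (eq_wOf hq h1 h2 ?_).symm
  rw [betaEnergy, div_mul_cancel₀ _ ((wCrit_pos hq).trans h1).ne']

theorem energy_of_betaC_lt {q : ℕ} (hq : 3 ≤ q) {β : ℝ} (hβ : betaC q < β) {ν : Fin q → ℝ}
    (hν : ν ∈ canonicalEq q β) : energy ν = spikeEnergy q (wOf q β) := by
  obtain ⟨-, -, i, rfl⟩ := eq_spike_wOf_of_mem_canonicalEq hq hβ hν
  exact energy_spike i _

theorem microEq_eq_canonicalEq_betaEnergy {q : ℕ} (hq : 3 ≤ q) {u : ℝ}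
    (hu : u ∈ Set.Ioo (-(1 / 2)) (uZero q)) :
    microEq q u = canonicalEq q (betaEnergy q u) :=
  microEq_eq_of_forall (canonicalEq_nonempty (by lia) _) fun ν hν => by
    rw [energy_of_betaC_lt hq (betaC_lt_betaEnergy hq hu) hν, wOf_betaEnergy hq hu,
      spikeEnergy_wEnergy hq hu.2]

theorem spikeEnergy_wOf_of_microEq_eq {q : ℕ} (hq : 3 ≤ q) {u β : ℝ} (hβ : betaC q < β)
    (h : microEq q u = canonicalEq q β) : spikeEnergy q (wOf q β) = u := by
  obtain ⟨ν, hν⟩ := canonicalEq_nonempty (by lia : 0 < q) β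
  rw [← energy_of_betaC_lt hq hβ hν]
  rw [← h] at hν
  exact hν.2.1

theorem eq_betaEnergy_of_microEq_eq {q : ℕ} (hq : 3 ≤ q) {u β : ℝ}
    (hu : u ∈ Set.Ioo (-(1 / 2)) (uZero q)) (hβ : betaC q < β)
    (h : microEq q u = canonicalEq q β) : β = betaEnergy q u := by
  have h1 := spikeEnergy_wOf_of_microEq_eq hq hβ h
  obtain ⟨h2, h3⟩ := wOf_spec hq hβ
  have h0 := (wCrit_pos hq).trans h2
  have hw : wOf q β = wEnergy q u := by
    refine (spikeEnergy_strictAntiOn hq).injOn h0.le (Real.sqrt_nonneg _) ?_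
    rw [h1, spikeEnergy_wEnergy hq hu.2]
  rw [betaEnergy, ← hw, h3, mul_div_cancel_right₀ _ h0.ne']

theorem microEntropy_eq_spikeEntropy {q : ℕ} (hq : 3 ≤ q) {u : ℝ}
    (hu : u ∈ Set.Ioo (-(1 / 2)) (uZero q)) :
    microEntropy q u = ((-spikeEntropy q (wEnergy q u) : ℝ) : EReal) := by
  have hβ := betaC_lt_betaEnergy hq hu
  obtain ⟨ν, hν⟩ := canonicalEq_nonempty (by lia : 0 < q) (betaEnergy q u)
  have hν' := hν
  rw [← microEq_eq_canonicalEq_betaEnergy hq hu] at hν'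
  obtain ⟨-, -, i, rfl⟩ := eq_spike_wOf_of_mem_canonicalEq hq hβ hν
  rw [microEntropy_of_mem hν', relEntropy_spike, wOf_betaEnergy hq hu]

/-- Here `w' = -q / ((q - 1) * w)`, which turns minus the derivative of `spikeEntropy` into
`meanField q w / w`. -/
theorem hasDerivAt_microEntropy {q : ℕ} (hq : 3 ≤ q) {u : ℝ}
    (hu : u ∈ Set.Ioo (-(1 / 2)) (uZero q)) :
    HasDerivAt (fun v => (microEntropy q v).toReal) (betaEnergy q u) u := by
  have h3 := three_le_cast hq
  have hne : (q : ℝ) - 1 ≠ 0 := by linarith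
  obtain ⟨h1, h2⟩ := wEnergy_mem_Ioo hq hu
  have h0 := (wCrit_pos hq).trans h1
  have d1 : HasDerivAt (fun v : ℝ => (-2 * q * v - 1) / ((q : ℝ) - 1))
      (-2 * q / ((q : ℝ) - 1)) u := by
    simpa using (((hasDerivAt_id' u).const_mul (-2 * (q : ℝ))).sub_const 1).div_const ((q : ℝ) - 1)
  have d2 : HasDerivAt (wEnergy q) _ u := d1.sqrt (wEnergy_arg_pos hq hu.2).ne'
  have d3 : HasDerivAt (fun v => -spikeEntropy q (wEnergy q v)) _ u :=
    ((hasDerivAt_spikeEntropy hq h0.le h2).comp u d2).neg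
  refine (d3.congr_of_eventuallyEq ?_).congr_deriv ?_
  · filter_upwards [Ioo_mem_nhds hu.1 hu.2] with v hv
    rw [microEntropy_eq_spikeEntropy hq hv, EReal.toReal_coe]
  · rw [betaEnergy, ← wEnergy]
    field_simp

/-! ### The set `F`, coexistence and the energy gap -/

theorem interior_setF {q : ℕ} (hq : 3 ≤ q) :
    interior (setF q) = Set.Ioo (-(1 / 2)) (uZero q) := by
  have hlt := uZero_lt_uC hq
  refine Set.Subset.antisymm (fun x hx => ?_)
    (interior_maximal Set.subset_union_left isOpen_Ioo)
  rcases interior_subset hx with h | h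
  · exact h
  · rw [Set.mem_singleton_iff] at h
    subst h
    exfalso
    have hx' := mem_interior_iff_mem_nhds.1 hx
    -- Points just to the left of `uC q` fall in the gap above `uZero q`.
    have h2 : ∀ᶠ y in nhdsWithin (uC q) (Set.Iio (uC q)), y ∈ setF q := nhdsWithin_le_nhds hx'
    obtain ⟨y, hy, hy1⟩ := (h2.and (Ioo_mem_nhdsLT hlt)).exists
    rcases hy with h | h
    · exact h.2.not_gt hy1.1
    · exact hy1.2.ne h

theorem canonicalEq_betaC_eq_union {q : ℕ} (hq : 3 ≤ q) :
    canonicalEq q (betaC q) = microEq q (uZero q) ∪ microEq q (uC q) := by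
  have h1 := microEq_eq_inter (spike_wCrit_mem_canonicalEq hq ⟨0, by lia⟩)
  have h2 := microEq_eq_inter (rho_mem_canonicalEq_betaC hq)
  rw [energy_spike_eq_spikeEnergy, spikeEnergy_wCrit hq] at h1
  rw [energy_rho (by lia)] at h2
  rw [h1, h2, ← Set.inter_union_distrib_left, eq_comm, Set.inter_eq_left]
  intro ν hν
  obtain ⟨i, rfl | rfl⟩ := eq_spike_of_mem_canonicalEq_betaC hq hν
  · exact Or.inr ((energy_spike_eq_spikeEnergy i 0).trans (spikeEnergy_zero q))
  · exact Or.inl ((energy_spike_eq_spikeEnergy i _).trans (spikeEnergy_wCrit hq))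

theorem microEq_uZero_ssubset {q : ℕ} (hq : 3 ≤ q) :
    microEq q (uZero q) ⊂ canonicalEq q (betaC q) := by
  rw [Set.ssubset_iff_of_subset
    (by rw [canonicalEq_betaC_eq_union hq]; exact Set.subset_union_left)]
  refine ⟨rho q, rho_mem_canonicalEq_betaC hq, fun h => (uZero_lt_uC hq).ne ?_⟩
  rw [← h.2.1, energy_rho (by lia)]

/-- Canonical energies jump over the gap: they equal `uC q` below `betaC q`, are `uZero q` or `uC q`
at it, and lie under `uZero q` above it. -/
theorem microEq_inter_canonicalEq_eq_empty {q : ℕ} (hq : 3 ≤ q) {u : ℝ}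
    (hu : u ∈ Set.Ioo (uZero q) (uC q)) (β : ℝ) : microEq q u ∩ canonicalEq q β = ∅ := by
  rw [Set.eq_empty_iff_forall_notMem]
  rintro ν ⟨h1, h2⟩
  have he := h1.2.1
  rcases lt_trichotomy β (betaC q) with hβ | rfl | hβ
  · rw [energy_of_lt_betaC hq hβ h2] at he
    exact hu.2.ne' he
  · rw [canonicalEq_betaC_eq_union hq] at h2
    rcases h2 with h2 | h2
    · exact hu.1.ne (h2.2.1.symm.trans he)
    · exact hu.2.ne' (h2.2.1.symm.trans he)
  · have hw := (wOf_spec hq hβ).1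
    have hc := wCrit_pos hq
    have := spikeEnergy_strictAntiOn hq hc.le (hc.trans hw).le hw
    rw [← energy_of_betaC_lt hq hβ h2, he, spikeEnergy_wCrit hq] at this
    exact this.not_gt hu.1

end CurieWeissPotts

theorem mainTheorem2 (q : ℕ) (hq : 3 ≤ q) :
    interior (CurieWeissPotts.setF q) = Set.Ioo (-(1 / 2)) (CurieWeissPotts.uZero q) ∧
    -- parts (a) and (b)
    (∀ u ∈ Set.Ioo (-(1 / 2)) (CurieWeissPotts.uZero q),
      (∃! β : ℝ, CurieWeissPotts.betaC q < β ∧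
        CurieWeissPotts.microEq q u = CurieWeissPotts.canonicalEq q β) ∧
      -- the extended-valued entropy is finite near `u`, and its real value is differentiable
      (∀ᶠ v in nhds u, CurieWeissPotts.microEntropy q v ≠ ⊥ ∧
        CurieWeissPotts.microEntropy q v ≠ ⊤) ∧
      DifferentiableAt ℝ (fun v => (CurieWeissPotts.microEntropy q v).toReal) u ∧
      (∀ β : ℝ, CurieWeissPotts.betaC q < β →
        CurieWeissPotts.microEq q u = CurieWeissPotts.canonicalEq q β →
        CurieWeissPotts.meanEnergy q β = u ∧
        CurieWeissPotts.energy (CurieWeissPotts.nuOne q β) = u ∧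
        HasDerivAt (fun v => (CurieWeissPotts.microEntropy q v).toReal) β u)) ∧
    -- part (c)
    (∀ β : ℝ, β < CurieWeissPotts.betaC q →
      CurieWeissPotts.microEq q (CurieWeissPotts.uC q) = CurieWeissPotts.canonicalEq q β) ∧
    -- part (d)
    (CurieWeissPotts.microEq q (CurieWeissPotts.uZero q) ⊂
        CurieWeissPotts.canonicalEq q (CurieWeissPotts.betaC q) ∧
      CurieWeissPotts.canonicalEq q (CurieWeissPotts.betaC q) =
        CurieWeissPotts.microEq q (CurieWeissPotts.uZero q) ∪
          CurieWeissPotts.microEq q (CurieWeissPotts.uC q)) ∧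
    -- part (e)
    (∀ u ∈ Set.Ioo (CurieWeissPotts.uZero q) (CurieWeissPotts.uC q), ∀ β : ℝ,
      CurieWeissPotts.microEq q u ∩ CurieWeissPotts.canonicalEq q β = ∅) := by
  refine ⟨CurieWeissPotts.interior_setF hq, fun u hu => ⟨?_, ?_, ?_, ?_⟩, fun β hβ => ?_,
    ⟨CurieWeissPotts.microEq_uZero_ssubset hq, CurieWeissPotts.canonicalEq_betaC_eq_union hq⟩,
    fun u hu β => CurieWeissPotts.microEq_inter_canonicalEq_eq_empty hq hu β⟩
  · exact ⟨CurieWeissPotts.betaEnergy q u,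
      ⟨CurieWeissPotts.betaC_lt_betaEnergy hq hu, CurieWeissPotts.microEq_eq_canonicalEq_betaEnergy hq hu⟩,
      fun β hβ => CurieWeissPotts.eq_betaEnergy_of_microEq_eq hq hu hβ.1 hβ.2⟩
  · filter_upwards [Ioo_mem_nhds hu.1 hu.2] with v hv
    rw [CurieWeissPotts.microEntropy_eq_spikeEntropy hq hv]
    exact ⟨EReal.coe_ne_bot _, EReal.coe_ne_top _⟩
  · exact (CurieWeissPotts.hasDerivAt_microEntropy hq hu).differentiableAt
  · intro β hβ h
    have he : CurieWeissPotts.energy (CurieWeissPotts.nuOne q β) = u := by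
      rw [CurieWeissPotts.nuOne, CurieWeissPotts.psi_eq_spike (by lia), CurieWeissPotts.energy_spike_eq_spikeEnergy,
        CurieWeissPotts.spikeEnergy_wOf_of_microEq_eq hq hβ h]
    refine ⟨by rw [CurieWeissPotts.meanEnergy, if_neg hβ.not_gt, he], he, ?_⟩
    rw [CurieWeissPotts.eq_betaEnergy_of_microEq_eq hq hu hβ h]
    exact CurieWeissPotts.hasDerivAt_microEntropy hq hu
  · exact CurieWeissPotts.microEq_eq_of_forall ⟨_, CurieWeissPotts.rho_mem_canonicalEq hq hβ.le⟩
      fun ν hν => CurieWeissPotts.energy_of_lt_betaC hq hβ hν
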